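/- Let $Y$ be a nonzero finite dimensional real normed space, $K \subseteq Y$ a closed convex cone with $K \cap (-K) = \{0\}$ that is generating ($K - K = Y$), and write $y \preceq_K z$ for $z - y \in K$. Let $A \subseteq \mathbb{R}^d$ be closed and convex, let $g_0, h_0 \colon \mathbb{R}^d \to \mathbb{R}$ be convex, and let $G, H \colon \mathbb{R}^d \to Y$ be $K$-convex, that is, $\Phi(\alpha x_1 + (1-\alpha)x_2) \preceq_K \alpha \Phi(x_1) + (1-\alpha)\Phi(x_2)$ for all $x_1, x_2 \in \mathbb{R}^d$, $\alpha \in [0,1]$ and $\Phi \in \{G, H\}$. Put $f_0 = g_0 - h_0$, $F = G - H$, and consider the problem $$(\mathcal{P}) \qquad \text{minimize } f_0(x) \quad \text{subject to } F(x) \preceq_K 0, \ x \in A.$$ Suppose that $G$ is continuous on $A$ and that $H$ is continuously Fréchet differentiable on $A$ (differentiable at each point of $A$, with $DH$ continuous on $A$). For $t \in Y^*$ write $t \succ_{K^*} 0$ if $\langle t, y\rangle > 0$ for all $y \in K \setminus \{0\}$. For $z \in A$, $v \in \mathbb{R}^d$ and $t \in Y^*$ let $\mathrm{Sub}(z, v,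 t)$ be the convex problem $$\min_{(x,s)} \ g_0(x) - \langle v, x - z\rangle + \langle t, s\rangle \quad \text{s.t. } G(x) - H(z) - DH(z)(x - z) \preceq_K s, \quad s \succeq_K 0, \quad x \in A.$$ *Penalty convex-concave procedure.* Given $x_0 \in A$, $t_0 \succ_{K^*} 0$, $\tau_{\max} > 0$, $\mu > 1$ and $\varkappa \ge 0$, for $n = 0, 1, 2, \dots$ choose $v_n \in \partial h_0(x_n)$, let $(x_{n+1}, s_{n+1})$ be a globally optimal solution of $\mathrm{Sub}(x_n, v_n, t_n)$, stop if $x_{n+1} = x_n$, and otherwise put $t_{n+1} = \mu t_n$ if $\|s_{n+1}\| \ge \varkappa$ and $\mu \|t_n\| \le \tau_{\max}$, and $t_{n+1} = t_n$ otherwise. The assertions below concern infinite sequences; they hold for all infinite sequences obtained by these rules, also if the stopping test is ignored. *Criticality.* A point $x_* \in A$ is a generalized critical point for $t \succ_{K^*} 0$ if there are $v_* \in \partial h_0(x_*)$ and $s_* \succeq_K 0$ such that $(x_*, s_*)$ is a globally optimal solution of $\mathrm{Sub}(x_*, v_*, t)$. A point $x_*$ is critical for $(\mathcal{P})$ if $\partial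 h_0(x_*) \cap (\partial g_0(x_*) + N_{\Omega(x_*)}(x_*)) \neq \emptyset$, where $\Omega(x_*) = \{x \in A : G(x) - H(x_*) - DH(x_*)(x - x_*) \preceq_K 0\}$ and $N_V(x) = \{u \in \mathbb{R}^d : \langle u, z - x\rangle \le 0 \ \forall z \in V\}$. **Theorem.** Let $t_0 \succ_{K^*} 0$. The minimum $c = \min\{\langle t_0, s\rangle : s \in K, \|s\| = 1\}$ exists and is positive. Suppose that the penalty function $\Phi_c(x) = f_0(x) + c \,\mathrm{dist}(F(x), -K)$ is bounded below on $A$, and let $\{x_n\}$, with penalty parameters $\{t_n\}$, be generated by the penalty convex-concave procedure started with $t_0$, with any $\tau_{\max} > 0$, $\mu > 1$, $\varkappa \ge 0$. Then the limit $t_* = \lim_{n\to\infty} t_n$ exists and all limit points of $\{x_n\}$ are generalized critical points for $t_*$. Suppose, in addition, that there is a largest integer $p \ge 0$ with $\|\mu^p t_0\| \le \tau_{\max}$ (that is, $\|t_0\| \le \tau_{\max}$), and that no point of $\{x \in A : \mathrm{dist}(F(x), -K) > \varkappa\}$ is a generalized critical point for $\widehat{t} = \mu^p t_0$. Then all limit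 points $x_*$ of $\{x_n\}$ satisfy $\mathrm{dist}(F(x_*), -K) \le \varkappa$. In particular, if $\varkappa = 0$, then all limit points of $\{x_n\}$ are feasible and critical for $(\mathcal{P})$. -/

import Mathlib

open Filter Topology
open scoped Pointwise

noncomputable section

/-- A map `Φ : X → Y` is convex with respect to the cone `K`, whose order is
`y ≼ z ↔ z - y ∈ K`. -/
def IsConeConvex {X Y : Type*} [AddCommGroup X] [Module ℝ X]
    [NormedAddCommGroup Y] [NormedSpace ℝ Y] (K : ProperCone ℝ Y) (Φ : X → Y) : Prop :=
  ∀ x₁ x₂ : X, ∀ α : ℝ, 0 ≤ α → α ≤ 1 →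
    α • Φ x₁ + (1 - α) • Φ x₂ - Φ (α • x₁ + (1 - α) • x₂) ∈ K

/-- The cone `K` is generating: `K - K = Y`. -/
def IsGeneratingCone {Y : Type*} [NormedAddCommGroup Y] [NormedSpace ℝ Y]
    (K : ProperCone ℝ Y) : Prop :=
  (K : Set Y) - (K : Set Y) = Set.univ

/-- `t ≻ 0` in the order of the dual cone `K*`: `t ∈ K*` and `⟨t, y⟩ > 0` for all nonzero
`y ∈ K`. -/
def IsStrictlyPositiveOn {Y : Type*} [NormedAddCommGroup Y] [NormedSpace ℝ Y]
    (K : ProperCone ℝ Y) (t : Y →L[ℝ] ℝ) : Prop :=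
  (∀ y ∈ K, 0 ≤ t y) ∧ ∀ y ∈ K, y ≠ 0 → 0 < t y

/-- The convex subdifferential of `h : ℝᵈ → ℝ` at `x`. -/
def convexSubdifferential {d : ℕ} (h : EuclideanSpace ℝ (Fin d) → ℝ)
    (x : EuclideanSpace ℝ (Fin d)) : Set (EuclideanSpace ℝ (Fin d)) :=
  {v | ∀ z, h x + inner ℝ v (z - x) ≤ h z}

/-- The normal cone to `V ⊆ ℝᵈ` at `x`. -/
def convexNormalCone {d : ℕ} (V : Set (EuclideanSpace ℝ (Fin d)))
    (x : EuclideanSpace ℝ (Fin d)) : Set (EuclideanSpace ℝ (Fin d)) :=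
  {v | ∀ z ∈ V, inner ℝ v (z - x) ≤ 0}

/-- `y` is a limit point of the sequence `x`: some subsequence of `x` converges to `y`. -/
def IsSeqLimitPoint {X : Type*} [TopologicalSpace X] (x : ℕ → X) (y : X) : Prop :=
  ∃ φ : ℕ → ℕ, StrictMono φ ∧ Tendsto (x ∘ φ) atTop (𝓝 y)

/-- The data of the cone constrained DC problem: minimize `g₀ x - h₀ x` over `x ∈ A` with
`G x - H x ≼ 0`. A `ProperCone` of Mathlib is a closed convex cone that contains `0`;
`K ∩ (-K) = {0}` is the field `salient`. Finite convex functions on `ℝᵈ` are continuous, so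
`g₀` and `h₀` are closed. -/
structure ConeDCProblem (d : ℕ) (Y : Type*) [NormedAddCommGroup Y] [NormedSpace ℝ Y] where
  g₀ : EuclideanSpace ℝ (Fin d) → ℝ
  h₀ : EuclideanSpace ℝ (Fin d) → ℝ
  G : EuclideanSpace ℝ (Fin d) → Y
  H : EuclideanSpace ℝ (Fin d) → Y
  K : ProperCone ℝ Y
  A : Set (EuclideanSpace ℝ (Fin d))
  convex_g₀ : ConvexOn ℝ Set.univ g₀
  convex_h₀ : ConvexOn ℝ Set.univ h₀
  salient : ∀ y ∈ K, -y ∈ K → y = 0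
  coneConvex_G : IsConeConvex K G
  coneConvex_H : IsConeConvex K H
  isClosed_A : IsClosed A
  convex_A : Convex ℝ A

namespace ConeDCProblem

variable {d : ℕ} {Y : Type*} [NormedAddCommGroup Y] [NormedSpace ℝ Y] (P : ConeDCProblem d Y)

/-- The objective function `f₀ = g₀ - h₀`. -/
def f₀ (x : EuclideanSpace ℝ (Fin d)) : ℝ := P.g₀ x - P.h₀ x

/-- The constraint map `F = G - H`. -/
def F (x : EuclideanSpace ℝ (Fin d)) : Y := P.G x - P.H x

/-- `x` is feasible: `x ∈ A` and `F x ≼ 0`. -/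
def IsFeasible (x : EuclideanSpace ℝ (Fin d)) : Prop := x ∈ P.A ∧ -P.F x ∈ P.K

/-- The infeasibility measure `dist (F x, -K)`. -/
def infeasibility (x : EuclideanSpace ℝ (Fin d)) : ℝ :=
  Metric.infDist (P.F x) (-(P.K : Set Y))

/-- The penalty function `Φ_c = f₀ + c dist (F, -K)`. -/
def penaltyFunction (c : ℝ) (x : EuclideanSpace ℝ (Fin d)) : ℝ := P.f₀ x + c * P.infeasibility x

/-- The map `x ↦ G x - H z - DH(z)(x - z)`: the concave part of `F` is linearized at `z`. -/
def linearization (z x : EuclideanSpace ℝ (Fin d)) : Y :=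
  P.G x - P.H z - fderiv ℝ P.H z (x - z)

/-- The feasible region `Ω(z)` of the problem linearized at `z`. -/
def linearizedRegion (z : EuclideanSpace ℝ (Fin d)) : Set (EuclideanSpace ℝ (Fin d)) :=
  {x | x ∈ P.A ∧ -P.linearization z x ∈ P.K}

/-- `x` is critical: `∂h₀(x)` meets `∂g₀(x) + N_{Ω(x)}(x)`. -/
def IsCritical (x : EuclideanSpace ℝ (Fin d)) : Prop :=
  (convexSubdifferential P.h₀ x ∩
    (convexSubdifferential P.g₀ x + convexNormalCone (P.linearizedRegion x) x)).Nonempty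

/-- The feasible region of the penalized subproblem at `z`: pairs `(x, s)` with `x ∈ A`, `s ≽ 0`
and `G x - H z - DH(z)(x - z) ≼ s`. -/
def penalizedRegion (z : EuclideanSpace ℝ (Fin d)) : Set (EuclideanSpace ℝ (Fin d) × Y) :=
  {q | q.1 ∈ P.A ∧ q.2 ∈ P.K ∧ q.2 - P.linearization z q.1 ∈ P.K}

/-- The objective `g₀ x - ⟨v, x - z⟩ + ⟨t, s⟩` of the penalized subproblem at `z`. -/
def penalizedObjective (z v : EuclideanSpace ℝ (Fin d)) (t : Y →L[ℝ] ℝ)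
    (q : EuclideanSpace ℝ (Fin d) × Y) : ℝ :=
  P.g₀ q.1 - inner ℝ v (q.1 - z) + t q.2

/-- `q = (x, s)` is a globally optimal solution of the penalized subproblem at `z`. -/
def IsPenalizedSolution (z v : EuclideanSpace ℝ (Fin d)) (t : Y →L[ℝ] ℝ)
    (q : EuclideanSpace ℝ (Fin d) × Y) : Prop :=
  q ∈ P.penalizedRegion z ∧
    ∀ q' ∈ P.penalizedRegion z, P.penalizedObjective z v t q ≤ P.penalizedObjective z v t q'

/-- `x` is a generalized critical point for the vector `t ≻ 0`. -/
def IsGeneralizedCritical (t : Y →L[ℝ] ℝ) (x : EuclideanSpace ℝ (Fin d)) : Prop :=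
  x ∈ P.A ∧ IsStrictlyPositiveOn P.K t ∧
    ∃ v ∈ convexSubdifferential P.h₀ x, ∃ s ∈ P.K, P.IsPenalizedSolution x v t (x, s)

/-- The infinite sequences `x n`, `v n`, `s n`, `t n` are generated by the penalty
convex-concave procedure with initial penalty parameter `t₀`, maximal norm `τmax`, factor `μ` and
infeasibility tolerance `ϰ` (the value `s 0` plays no role). The procedure stops when
`x (n + 1) = x n`; a run that stops is finite and has no limit points, and every run that does not
stop satisfies this predicate. That `x (n + 1) ≠ x n` is not demanded. -/
structure IsPenaltyCCPSequence (t₀ : Y →L[ℝ] ℝ) (τmax μ ϰ : ℝ)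
    (x v : ℕ → EuclideanSpace ℝ (Fin d)) (s : ℕ → Y) (t : ℕ → Y →L[ℝ] ℝ) : Prop where
  x_zero_mem : x 0 ∈ P.A
  t_zero : t 0 = t₀
  subgradient : ∀ n, v n ∈ convexSubdifferential P.h₀ (x n)
  solution : ∀ n, P.IsPenalizedSolution (x n) (v n) (t n) (x (n + 1), s (n + 1))
  t_succ : ∀ n, t (n + 1) = if ϰ ≤ ‖s (n + 1)‖ ∧ μ * ‖t n‖ ≤ τmax then μ • t n else t n

end ConeDCProblem

end

/-! For fixed `t`, eliminating `s` turns the subproblem into minimizing `g₀ x - ⟨v, x - z⟩ + m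
(P.linearization z x)` over `A`, where `m y` is the least `⟨t, s⟩` with `s ≽ 0`, `s ≽ y`. Since `m`
is monotone and `H` is cone convex, this model, shifted by the constant `-h₀ z`, majorizes `ψ = f₀ +
m ∘ F` and touches it at `z` (`IsPenalizedSolution.le`). The parameter is always `μ ^ k • t₀` and
changes finitely often. From then on `ψ (x n)` decreases, and it is bounded below because `m y ≥ c
dist (y, -K)`. Its limit is `ψ y` at every limit point `y`; passing to the limit in the majorization
along convergent subgradients shows that `y` minimizes its own model. If the final exponent is `p`,
infeasible limit points are excluded by assumption. If it is smaller, the norm test never blocks an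
increase, so eventually `‖s n‖` stays at most `ϰ`, and it bounds the infeasibility. For `ϰ = 0`,
testing with `s = 0` and the sum rule give criticality. -/

/-- Sum rule for a finite convex function and the indicator of a convex set: if `g - ⟨v, ·⟩`
attains its minimum over the convex set `V` at `x`, then `v ∈ ∂g(x) + N_V(x)`. -/
theorem mem_convexSubdifferential_add_convexNormalCone {d : ℕ}
    {g : EuclideanSpace ℝ (Fin d) → ℝ} (hg : ConvexOn ℝ Set.univ g)
    {V : Set (EuclideanSpace ℝ (Fin d))} (hV : Convex ℝ V) {x v : EuclideanSpace ℝ (Fin d)}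
    (hx : x ∈ V) (hmin : ∀ z ∈ V, g x + inner ℝ v (z - x) ≤ g z) :
    v ∈ convexSubdifferential g x + convexNormalCone V x := by
  have hgc : Continuous g := hg.locallyLipschitz.continuous
  have hopen : IsOpen {p : EuclideanSpace ℝ (Fin d) × ℝ | p.1 ∈ Set.univ ∧ g p.1 < p.2} := by
    simpa using isOpen_lt (hgc.comp continuous_fst) continuous_snd
  have hT : Convex ℝ {p : EuclideanSpace ℝ (Fin d) × ℝ |
      p.1 ∈ V ∧ p.2 ≤ g x + inner ℝ v (p.1 - x)} := by
    rintro ⟨a, r⟩ ⟨ha, hr⟩ ⟨b, q⟩ ⟨hb, hq⟩ α β hα hβ hαβ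
    refine ⟨hV ha hb hα hβ hαβ, ?_⟩
    have h1 := mul_le_mul_of_nonneg_left hr hα
    have h2 := mul_le_mul_of_nonneg_left hq hβ
    obtain rfl : α = 1 - β := by linarith
    simp only [Prod.smul_mk, Prod.mk_add_mk, smul_eq_mul, inner_sub_right, inner_add_right,
      inner_smul_right] at *
    linarith
  -- Separate the open strict epigraph of `g` from the region over `V` below the affine function
  -- touching `g` at `x`.
  obtain ⟨f, u, hS, hT⟩ := geometric_hahn_banach_open hg.convex_strict_epigraph hopen hT (by
    rw [Set.disjoint_left]
    rintro ⟨z, r⟩ ⟨-, h1⟩ ⟨h2, h3⟩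
    exact absurd (hmin z h2) (not_le.2 (h1.trans_le h3)))
  obtain ⟨l, hl⟩ : ∃ l : EuclideanSpace ℝ (Fin d) →L[ℝ] ℝ, ∀ z, l z = f (z, 0) :=
    ⟨f.comp (ContinuousLinearMap.inl ℝ _ _), fun z => by simp⟩
  set β := f (0, 1) with hβ
  have hf : ∀ z r, f (z, r) = l z + r * β := fun z r => by
    rw [hl, hβ, ← smul_eq_mul, ← map_smul, ← map_add]; simp
  have hx0 : u ≤ l x + g x * β := by
    have := hT (x, g x) ⟨hx, by simp⟩
    rwa [hf] at this
  have hx1 : l x + (g x + 1) * β < u := by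
    have := hS (x, g x + 1) ⟨trivial, by simp⟩
    rwa [hf] at this
  -- The separating hyperplane is not vertical: both sets contain points above or on the graph over
  -- the same `x`, so no constraint qualification is needed.
  have hβ0 : β < 0 := by linarith
  have hepi : ∀ z, l z + g z * β ≤ u := fun z => by
    refine le_of_forall_pos_le_add fun ε hε => ?_
    have := hS (z, g z + ε / (-β)) ⟨trivial, by
      have := div_pos hε (neg_pos.2 hβ0); simpa using this⟩
    rw [hf] at this
    have h2 : ε / (-β) * β = -ε := by rw [div_neg, neg_mul, div_mul_cancel₀ _ hβ0.ne]
    linarith [add_mul (g z) (ε / (-β)) β]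
  have hw : ∀ z, inner ℝ ((InnerProductSpace.toDual ℝ _).symm ((-β)⁻¹ • l)) z = (-β)⁻¹ * l z :=
    fun z => by rw [InnerProductSpace.toDual_symm_apply]; rfl
  have hβi : 0 < (-β)⁻¹ := inv_pos.2 (neg_pos.2 hβ0)
  have hββ : (-β)⁻¹ * β = -1 := by rw [inv_neg, neg_mul, inv_mul_cancel₀ hβ0.ne]
  -- Normalizing by `-β` makes the slope of the hyperplane a subgradient of `g`; the remainder of
  -- `v` is normal to `V`.
  refine ⟨(InnerProductSpace.toDual ℝ _).symm ((-β)⁻¹ • l), fun z => ?_, _, fun z hz => ?_,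
    add_sub_cancel _ v⟩
  · rw [hw, map_sub]
    have := mul_le_mul_of_nonneg_left ((hepi z).trans hx0) hβi.le
    linear_combination this - (g z - g x) * hββ
  · rw [inner_sub_left, hw, map_sub]
    have := hT (z, g x + inner ℝ v (z - x)) ⟨hz, le_rfl⟩
    rw [hf] at this
    have := mul_le_mul_of_nonneg_left ((hepi x).trans this) hβi.le
    linear_combination this + inner ℝ v (z - x) * hββ

/-- The subgradients of a finite convex function are bounded near every point. -/
theorem exists_bound_convexSubdifferential {d : ℕ}
    {h : EuclideanSpace ℝ (Fin d) → ℝ} (hh : ConvexOn ℝ Set.univ h)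
    (y : EuclideanSpace ℝ (Fin d)) :
    ∃ R : ℝ, ∀ x, dist x y ≤ 1 → ∀ v ∈ convexSubdifferential h x, ‖v‖ ≤ R := by
  have hc : Continuous h := hh.locallyLipschitz.continuous
  obtain ⟨M, hM⟩ := (isCompact_closedBall y (2 : ℝ)).exists_bound_of_continuousOn hc.continuousOn
  refine ⟨M + M, fun x hx v hv => ?_⟩
  -- A unit step along `v` raises `h` by at least `‖v‖` and stays in the ball of radius 2. For `v =
  -- 0` the step is zero.
  have hnv : ‖‖v‖⁻¹ • v‖ ≤ 1 := by
    rw [norm_smul, norm_inv, norm_norm]; exact inv_mul_le_one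
  have h1 := hv (x + ‖v‖⁻¹ • v)
  have h2 : inner ℝ v (x + ‖v‖⁻¹ • v - x) = ‖v‖ := by
    rw [add_sub_cancel_left, inner_smul_right, real_inner_self_eq_norm_sq]
    rcases eq_or_ne ‖v‖ 0 with h | h
    · simp [h]
    · field_simp
  have h3 := hM x (Metric.mem_closedBall.2 (by linarith))
  have h4 := hM (x + ‖v‖⁻¹ • v) (Metric.mem_closedBall.2 (by
    rw [dist_eq_norm] at *
    calc ‖x + ‖v‖⁻¹ • v - y‖ = ‖(x - y) + ‖v‖⁻¹ • v‖ := by congr 1; abel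
      _ ≤ ‖x - y‖ + ‖‖v‖⁻¹ • v‖ := norm_add_le _ _
      _ ≤ 2 := by linarith))
  rw [Real.norm_eq_abs, abs_le] at h3 h4
  linarith

/-! ### Cone order and the penalty value function -/

section Cone

variable {Y : Type*} [NormedAddCommGroup Y] [NormedSpace ℝ Y]

/-- The gradient inequality of a cone convex map. -/
theorem IsConeConvex.sub_sub_fderiv_mem {X : Type*} [NormedAddCommGroup X] [NormedSpace ℝ X]
    {K : ProperCone ℝ Y} {Φ : X → Y} (hΦ : IsConeConvex K Φ) {z : X}
    (hz : DifferentiableAt ℝ Φ z) (x : X) : Φ x - Φ z - fderiv ℝ Φ z (x - z) ∈ K := by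
  -- Cone convexity divided by `r` bounds the difference quotients; the closed cone keeps the bound
  -- as `r` tends to 0 from the right.
  have h := (hz.hasFDerivAt.hasLineDerivAt (x - z)).tendsto_slope_zero_right
  refine K.isClosed.mem_of_tendsto (h.const_sub (Φ x - Φ z)) ?_
  filter_upwards [Ioo_mem_nhdsGT one_pos] with r hr
  have h1 := K.smul_mem (hΦ x z r hr.1.le hr.2.le) (inv_nonneg.2 hr.1.le)
  have e1 : z + r • (x - z) = r • x + (1 - r) • z := by module
  have e2 : r • Φ x + (1 - r) • Φ z - Φ (r • x + (1 - r) • z) =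
      r • (Φ x - Φ z) - (Φ (z + r • (x - z)) - Φ z) := by rw [e1]; module
  rwa [e2, smul_sub, inv_smul_smul₀ hr.1.ne'] at h1

variable {K : ProperCone ℝ Y} {t : Y →L[ℝ] ℝ}

theorem IsGeneratingCone.exists_ne_zero [Nontrivial Y] (hK : IsGeneratingCone K) :
    ∃ y ∈ K, y ≠ 0 := by
  by_contra! h
  obtain ⟨y, hy⟩ := exists_ne (0 : Y)
  obtain ⟨a, ha, b, hb, hab⟩ : y ∈ (K : Set Y) - (K : Set Y) := by rw [hK]; trivial
  apply hy
  rw [← hab, h a ha, h b hb]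
  exact sub_zero 0

theorem mul_norm_le_of_isLeast {c : ℝ} (hc : IsLeast {r : ℝ | ∃ s ∈ K, ‖s‖ = 1 ∧ r = t s} c)
    {s : Y} (hs : s ∈ K) : c * ‖s‖ ≤ t s := by
  rcases eq_or_ne s 0 with rfl | h
  · simp
  · have hn : 0 < ‖s‖ := norm_pos_iff.2 h
    have := hc.2 ⟨‖s‖⁻¹ • s, K.smul_mem hs (by positivity), by simp [norm_smul, h], rfl⟩
    rw [map_smul, smul_eq_mul, inv_mul_eq_div, le_div_iff₀ hn] at this
    exact this

variable [FiniteDimensional ℝ Y]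

/-- A strictly positive functional attains a positive minimum on the unit sphere of the cone. -/
theorem IsStrictlyPositiveOn.exists_isLeast [Nontrivial Y] (hK : IsGeneratingCone K)
    (ht : IsStrictlyPositiveOn K t) :
    ∃ c : ℝ, IsLeast {r : ℝ | ∃ s ∈ K, ‖s‖ = 1 ∧ r = t s} c ∧ 0 < c := by
  obtain ⟨y, hy, hy0⟩ := hK.exists_ne_zero
  have hcomp : IsCompact (Metric.sphere (0 : Y) 1 ∩ K) := (isCompact_sphere 0 1).inter_right
    K.isClosed
  obtain ⟨s, ⟨hs1, hs⟩, hmin⟩ := hcomp.exists_isMinOn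
    ⟨‖y‖⁻¹ • y, by simp [norm_smul, hy0], K.smul_mem hy (by positivity)⟩ t.continuous.continuousOn
  have hs1 : ‖s‖ = 1 := by simpa using hs1
  refine ⟨t s, ⟨⟨s, hs, hs1, rfl⟩, ?_⟩, ht.2 s hs (by rintro rfl; simp at hs1)⟩
  rintro _ ⟨q, hq, hq1, rfl⟩
  exact hmin ⟨by simpa using hq1, hq⟩

/-- The value function `m y = min {⟨t, s⟩ : s ≽ 0, s ≽ y}`. -/
theorem exists_penaltyValue [Nontrivial Y] (hK : IsGeneratingCone K)
    (ht : IsStrictlyPositiveOn K t) :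
    ∃ m : Y → ℝ, Continuous m ∧ (∀ y z, z - y ∈ K → m y ≤ m z) ∧
      (∀ y, ∃ s ∈ K, s - y ∈ K ∧ t s = m y) ∧ ∀ y, ∀ s ∈ K, s - y ∈ K → m y ≤ t s := by
  obtain ⟨c, hc, hc0⟩ := ht.exists_isLeast hK
  have hatt : ∀ y : Y, ∃ s ∈ K, s - y ∈ K ∧ ∀ q ∈ K, q - y ∈ K → t s ≤ t q := fun y => by
    -- Generation supplies a feasible `a`. Since `c ‖q‖ ≤ t q` on `K`, competitors no worse than `a`
    -- lie in a compact set.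
    obtain ⟨a, ha, b, hb, hab⟩ : y ∈ (K : Set Y) - (K : Set Y) := by rw [hK]; trivial
    have hay : a - y ∈ K := by rw [← hab]; simpa using hb
    have hclosed : IsClosed {q : Y | q ∈ K ∧ q - y ∈ K} :=
      K.isClosed.inter (K.isClosed.preimage (continuous_id.sub continuous_const))
    have hcomp : IsCompact (Metric.closedBall (0 : Y) (t a / c) ∩ {q : Y | q ∈ K ∧ q - y ∈ K}) :=
      (isCompact_closedBall 0 _).inter_right hclosed
    have hball : ∀ q ∈ K, t q ≤ t a → q ∈ Metric.closedBall (0 : Y) (t a / c) := fun q hq hqa => by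
      rw [mem_closedBall_zero_iff, le_div_iff₀ hc0, mul_comm]
      exact (mul_norm_le_of_isLeast hc hq).trans hqa
    obtain ⟨s, ⟨-, hs⟩, hmin⟩ := hcomp.exists_isMinOn ⟨a, hball a ha le_rfl, ha, hay⟩
      t.continuous.continuousOn
    refine ⟨s, hs.1, hs.2, fun q hq hqy => ?_⟩
    rcases le_total (t q) (t a) with h | h
    · exact hmin ⟨hball q hq h, hq, hqy⟩
    · exact le_trans (hmin ⟨hball a ha le_rfl, ha, hay⟩) h
  choose σ hσK hσ hmin using hatt
  refine ⟨fun y => t (σ y), ?_, fun y z hyz => ?_, fun y => ⟨σ y, hσK y, hσ y, rfl⟩, hmin⟩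
  -- Continuity comes from convexity: a finite convex function on a finite dimensional space is
  -- locally Lipschitz.
  · refine (ConvexOn.locallyLipschitz ⟨convex_univ, fun y _ z _ a b ha hb _ => ?_⟩).continuous
    have := hmin (a • y + b • z) (a • σ y + b • σ z)
      (K.add_mem (K.smul_mem (hσK y) ha) (K.smul_mem (hσK z) hb)) (by
        have e : a • σ y + b • σ z - (a • y + b • z) = a • (σ y - y) + b • (σ z - z) := by module
        rw [e]
        exact add_mem (K.smul_mem (hσ y) ha) (K.smul_mem (hσ z) hb))
    simpa using this
  · refine hmin y (σ z) (hσK z) ?_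
    rw [← sub_add_sub_cancel _ z]
    exact add_mem (hσ z) hyz

end Cone

/-! ### Linearization, criticality and majorization -/

namespace ConeDCProblem

variable {d : ℕ} {Y : Type*} [NormedAddCommGroup Y] [NormedSpace ℝ Y] {P : ConeDCProblem d Y}

theorem continuous_g₀ : Continuous P.g₀ := P.convex_g₀.locallyLipschitz.continuous

theorem continuous_h₀ : Continuous P.h₀ := P.convex_h₀.locallyLipschitz.continuous

theorem continuousOn_F (hG : ContinuousOn P.G P.A) (hH : ∀ x ∈ P.A, DifferentiableAt ℝ P.H x) :
    ContinuousOn P.F P.A :=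
  hG.sub fun x hx => (hH x hx).continuousAt.continuousWithinAt

theorem linearization_self (z : EuclideanSpace ℝ (Fin d)) : P.linearization z z = P.F z := by
  simp [linearization, F]

theorem linearization_sub_F_mem {z : EuclideanSpace ℝ (Fin d)} (hz : DifferentiableAt ℝ P.H z)
    (x : EuclideanSpace ℝ (Fin d)) : P.linearization z x - P.F x ∈ P.K := by
  have h := P.coneConvex_H.sub_sub_fderiv_mem hz x
  have e : P.linearization z x - P.F x = P.H x - P.H z - fderiv ℝ P.H z (x - z) := by
    rw [linearization, F]; abel
  rwa [e]

theorem convex_linearizedRegion (z : EuclideanSpace ℝ (Fin d)) :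
    Convex ℝ (P.linearizedRegion z) := by
  rintro a ⟨ha, ha'⟩ b ⟨hb, hb'⟩ α β hα hβ hαβ
  refine ⟨P.convex_A ha hb hα hβ hαβ, ?_⟩
  obtain rfl : β = 1 - α := by linarith
  have h := P.coneConvex_G a b α hα (by linarith)
  have e1 : α • a + (1 - α) • b - z = α • (a - z) + (1 - α) • (b - z) := by module
  have e : -P.linearization z (α • a + (1 - α) • b) =
      α • -P.linearization z a + (1 - α) • -P.linearization z b +
        (α • P.G a + (1 - α) • P.G b - P.G (α • a + (1 - α) • b)) := by
    simp only [linearization]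
    rw [e1, map_add, map_smul, map_smul]
    module
  rw [e]
  exact add_mem (add_mem (P.K.smul_mem ha' hα) (P.K.smul_mem hb' hβ)) h

theorem infeasibility_le_norm {x : EuclideanSpace ℝ (Fin d)} {s : Y} (h : s - P.F x ∈ P.K) :
    P.infeasibility x ≤ ‖s‖ := by
  have h1 : P.F x - s ∈ -(P.K : Set Y) := by simpa using h
  simpa [infeasibility, dist_eq_norm] using Metric.infDist_le_dist_of_mem (x := P.F x) h1

theorem neg_F_mem_of_infeasibility_eq_zero {x : EuclideanSpace ℝ (Fin d)}
    (h : P.infeasibility x = 0) : -P.F x ∈ P.K := by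
  have := (P.K.isClosed.neg.mem_iff_infDist_zero ⟨0, by simp⟩).2 h
  simpa using this

/-- A feasible generalized critical point is critical. -/
theorem IsGeneralizedCritical.isCritical {t : Y →L[ℝ] ℝ} {x : EuclideanSpace ℝ (Fin d)}
    (h : P.IsGeneralizedCritical t x) (hF : -P.F x ∈ P.K) : P.IsCritical x := by
  obtain ⟨hA, ht, v, hv, s, hs, hsol⟩ := h
  refine ⟨v, hv, mem_convexSubdifferential_add_convexNormalCone P.convex_g₀
    (P.convex_linearizedRegion x) ⟨hA, by rwa [linearization_self]⟩ fun z hz => ?_⟩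
  -- Points of the linearized region need no slack, and dropping `t s ≥ 0` only strengthens the
  -- minimality of `x`.
  have h1 := hsol.2 (z, 0) ⟨hz.1, zero_mem _, by simpa using hz.2⟩
  have h2 := ht.1 s hs
  simp only [penalizedObjective, sub_self, inner_zero_right, map_zero] at h1
  linarith

/-- The exact penalty function at a solution of the penalized subproblem is bounded by the optimal
value of the majorizing convex model at any point of `A`. -/
theorem IsPenalizedSolution.le {z v x' : EuclideanSpace ℝ (Fin d)} {t : Y →L[ℝ] ℝ} {s : Y}
    (hsol : P.IsPenalizedSolution z v t (x', s)) (hv : v ∈ convexSubdifferential P.h₀ z)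
    (hz : DifferentiableAt ℝ P.H z) {m : Y → ℝ} (hmono : ∀ y z, z - y ∈ P.K → m y ≤ m z)
    (hatt : ∀ y, ∃ s ∈ P.K, s - y ∈ P.K ∧ t s = m y)
    (hle : ∀ y, ∀ s ∈ P.K, s - y ∈ P.K → m y ≤ t s)
    {x : EuclideanSpace ℝ (Fin d)} (hx : x ∈ P.A) :
    P.f₀ x' + m (P.F x') ≤
      P.g₀ x - P.h₀ z - inner ℝ v (x - z) + m (P.linearization z x) := by
  obtain ⟨q, hq, hqx, hqm⟩ := hatt (P.linearization z x)
  have h1 := hsol.2 (x, q) ⟨hx, hq, hqx⟩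
  have h2 := hmono _ _ (P.linearization_sub_F_mem hz x')
  have h3 := hle _ s hsol.1.2.1 hsol.1.2.2
  have h4 := hv x'
  simp only [penalizedObjective] at h1
  rw [f₀]
  linarith

/-! ### Convergence of the iterates -/

section Sequence

variable {t₀ : Y →L[ℝ] ℝ} {τmax μ ϰ : ℝ} {x v : ℕ → EuclideanSpace ℝ (Fin d)} {s : ℕ → Y}
  {t : ℕ → Y →L[ℝ] ℝ}

theorem IsPenaltyCCPSequence.mem (h : P.IsPenaltyCCPSequence t₀ τmax μ ϰ x v s t) :
    ∀ n, x n ∈ P.A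
  | 0 => h.x_zero_mem
  | n + 1 => (h.solution n).1.1

theorem IsPenaltyCCPSequence.mem_of_limitPoint (h : P.IsPenaltyCCPSequence t₀ τmax μ ϰ x v s t)
    {y : EuclideanSpace ℝ (Fin d)} (hy : IsSeqLimitPoint x y) : y ∈ P.A :=
  let ⟨_, _, hφ⟩ := hy
  P.isClosed_A.mem_of_tendsto hφ (Eventually.of_forall fun _ => h.mem _)

/-- The penalty parameter is eventually constant. -/
theorem IsPenaltyCCPSequence.exists_eventually_eq
    (h : P.IsPenaltyCCPSequence t₀ τmax μ ϰ x v s t) (hμ : 1 < μ) (ht₀ : t₀ ≠ 0) :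
    ∃ q N : ℕ, (q = 0 ∨ ‖μ ^ q • t₀‖ ≤ τmax) ∧ ∀ n, N ≤ n → t n = μ ^ q • t₀ := by
  have hμ0 : 0 < μ := one_pos.trans hμ
  have hstep : ∀ n, ∃ k, t n = μ ^ k • t₀ ∧ (k = 0 ∨ ‖μ ^ k • t₀‖ ≤ τmax) := fun n => by
    induction n with
    | zero => exact ⟨0, by simp [h.t_zero], Or.inl rfl⟩
    | succ n ih =>
      obtain ⟨k, hk, hk'⟩ := ih
      rw [h.t_succ]
      split_ifs with hc
      · refine ⟨k + 1, by rw [hk, smul_smul, pow_succ'], Or.inr ?_⟩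
        rw [pow_succ', ← smul_smul, ← hk, norm_smul, Real.norm_of_nonneg hμ0.le]
        exact hc.2
      · exact ⟨k, hk, hk'⟩
  -- `S` collects the exponents that occur. The case `k = 0` is separate because `‖t₀‖` may exceed
  -- `τmax`. Once the largest exponent occurs, a further increase would contradict maximality.
  set S : Set ℕ := {k | (∃ n, t n = μ ^ k • t₀) ∧ (k = 0 ∨ ‖μ ^ k • t₀‖ ≤ τmax)} with hS
  have hbdd : BddAbove S := by
    obtain ⟨B, hB⟩ := pow_unbounded_of_one_lt (τmax / ‖t₀‖) hμ
    refine ⟨B, fun k hk => ?_⟩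
    rcases hk.2 with h0 | hk
    · omega
    · by_contra! hlt
      rw [norm_smul, norm_pow, Real.norm_of_nonneg hμ0.le, ← le_div_iff₀ (norm_pos_iff.2 ht₀)] at hk
      exact absurd (hk.trans_lt hB) (not_lt.2 (pow_le_pow_right₀ hμ.le hlt.le))
  have hne : S.Nonempty := ⟨0, ⟨0, by simp [h.t_zero]⟩, Or.inl rfl⟩
  obtain ⟨⟨N, hN⟩, hq⟩ := Nat.sSup_mem hne hbdd
  refine ⟨sSup S, N, hq, fun n hn => ?_⟩
  induction n, hn using Nat.le_induction with
  | base => exact hN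
  | succ n hn ih =>
    have h1 := h.t_succ n
    split_ifs at h1 with hc
    · have h2 : sSup S + 1 ∈ S := by
        refine ⟨⟨n + 1, by rw [h1, ih, smul_smul, pow_succ']⟩, Or.inr ?_⟩
        rw [pow_succ', ← smul_smul, ← ih, norm_smul, Real.norm_of_nonneg hμ0.le]
        exact hc.2
      have := le_csSup hbdd h2
      omega
    · rw [h1, ih]

/-- The chain `F ≼ linearization ≼ s` at the new iterate makes `s` an admissible slack for `F`
itself. -/
theorem IsPenaltyCCPSequence.infeasibility_le_norm
    (h : P.IsPenaltyCCPSequence t₀ τmax μ ϰ x v s t)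
    (hH : ∀ x ∈ P.A, DifferentiableAt ℝ P.H x) (n : ℕ) :
    P.infeasibility (x (n + 1)) ≤ ‖s (n + 1)‖ := by
  refine ConeDCProblem.infeasibility_le_norm ?_
  rw [← sub_add_sub_cancel _ (P.linearization (x n) (x (n + 1)))]
  exact add_mem (h.solution n).1.2.2 (linearization_sub_F_mem (hH _ (h.mem n)) _)

/-- Limit points of iterates that are eventually almost feasible are almost feasible. -/
theorem infeasibility_le_of_limitPoint (hF : ContinuousOn P.F P.A) (hx : ∀ n, x n ∈ P.A) {N : ℕ}
    (hN : ∀ n, N ≤ n → P.infeasibility (x n) ≤ ϰ) {y : EuclideanSpace ℝ (Fin d)} (hyA : y ∈ P.A)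
    (hy : IsSeqLimitPoint x y) : P.infeasibility y ≤ ϰ := by
  obtain ⟨φ, hφ, hlim⟩ := hy
  have h1 : Tendsto (fun k => P.F (x (φ k))) atTop (𝓝 (P.F y)) :=
    (hF y hyA).tendsto.comp
      (tendsto_nhdsWithin_iff.2 ⟨hlim, Eventually.of_forall fun k => hx (φ k)⟩)
  refine le_of_tendsto (((Metric.continuous_infDist_pt _).tendsto _).comp h1) ?_
  filter_upwards [hφ.tendsto_atTop.eventually_ge_atTop N] with k hk using hN _ hk

/-- Limit points of the procedure with an eventually constant penalty parameter are generalized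
critical, provided the corresponding exact penalty function is bounded below. -/
theorem IsPenaltyCCPSequence.isGeneralizedCritical
    (h : P.IsPenaltyCCPSequence t₀ τmax μ ϰ x v s t) (hG : ContinuousOn P.G P.A)
    (hH : ∀ x ∈ P.A, DifferentiableAt ℝ P.H x) (hDH : ContinuousOn (fderiv ℝ P.H) P.A)
    {T : Y →L[ℝ] ℝ} (hT : IsStrictlyPositiveOn P.K T) {N : ℕ} (hN : ∀ n, N ≤ n → t n = T)
    {m : Y → ℝ} (hm : Continuous m) (hmono : ∀ y z, z - y ∈ P.K → m y ≤ m z)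
    (hatt : ∀ y, ∃ s ∈ P.K, s - y ∈ P.K ∧ T s = m y)
    (hle : ∀ y, ∀ s ∈ P.K, s - y ∈ P.K → m y ≤ T s)
    (hbdd : BddBelow ((fun x => P.f₀ x + m (P.F x)) '' P.A))
    {y : EuclideanSpace ℝ (Fin d)} (hy : IsSeqLimitPoint x y) : P.IsGeneralizedCritical T y := by
  have hyA := h.mem_of_limitPoint hy
  obtain ⟨φ, hφ, hlim⟩ := hy
  set ψ : EuclideanSpace ℝ (Fin d) → ℝ := fun x => P.f₀ x + m (P.F x) with hψ
  have hψc : ContinuousOn ψ P.A :=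
    (continuous_g₀.sub continuous_h₀).continuousOn.add
      (hm.comp_continuousOn (continuousOn_F hG hH))
  have hkey : ∀ n, N ≤ n → ∀ z ∈ P.A, ψ (x (n + 1)) ≤
      P.g₀ z - P.h₀ (x n) - inner ℝ (v n) (z - x n) + m (P.linearization (x n) z) :=
    fun n hn z hz => by
      have hs := h.solution n
      rw [hN n hn] at hs
      exact hs.le (h.subgradient n) (hH _ (h.mem n)) hmono hatt hle hz
  -- Take `z = x n`, where model and `ψ` agree.
  have hanti : Antitone fun n => ψ (x (n + N)) := antitone_nat_of_succ_le fun n => by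
    have := hkey (n + N) (Nat.le_add_left _ _) _ (h.mem (n + N))
    rw [linearization_self, sub_self, inner_zero_right, sub_zero] at this
    rwa [add_right_comm]
  have hbdd' : BddBelow (Set.range fun n => ψ (x (n + N))) :=
    hbdd.mono (Set.range_subset_iff.2 fun n => Set.mem_image_of_mem ψ (h.mem (n + N)))
  obtain ⟨L, hL⟩ : ∃ L, Tendsto (fun n => ψ (x n)) atTop (𝓝 L) :=
    ⟨_, (tendsto_add_atTop_iff_nat N).1 (tendsto_atTop_ciInf hanti hbdd')⟩
  obtain ⟨R, hR⟩ := exists_bound_convexSubdifferential P.convex_h₀ y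
  have hball : ∀ᶠ k in atTop, (v ∘ φ) k ∈ Metric.closedBall 0 R := by
    filter_upwards [hlim.eventually (Metric.closedBall_mem_nhds y one_pos)] with k hk
    exact mem_closedBall_zero_iff.2 (hR _ hk _ (h.subgradient _))
  obtain ⟨w, -, θ, hθ, hw⟩ := tendsto_subseq_of_frequently_bounded Metric.isBounded_closedBall
    hball.frequently
  set η : ℕ → ℕ := φ ∘ θ with hη
  have hηt : Tendsto η atTop atTop := (hφ.comp hθ).tendsto_atTop
  have hxη : Tendsto (fun k => x (η k)) atTop (𝓝 y) := hlim.comp hθ.tendsto_atTop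
  have hvη : Tendsto (fun k => v (η k)) atTop (𝓝 w) := hw
  have hxη' : Tendsto (fun k => x (η k)) atTop (𝓝[P.A] y) :=
    tendsto_nhdsWithin_iff.2 ⟨hxη, Eventually.of_forall fun k => h.mem _⟩
  have hhη : Tendsto (fun k => P.h₀ (x (η k))) atTop (𝓝 (P.h₀ y)) :=
    (continuous_h₀.tendsto y).comp hxη
  have hLy : L = ψ y :=
    tendsto_nhds_unique (hL.comp hηt) ((hψc y hyA).tendsto.comp hxη')
  have hinner : ∀ z, Tendsto (fun k => (inner ℝ (v (η k)) (z - x (η k)) : ℝ)) atTop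
      (𝓝 (inner ℝ w (z - y))) := fun z => hvη.inner (hxη.const_sub z)
  have hDHη : Tendsto (fun k => fderiv ℝ P.H (x (η k))) atTop (𝓝 (fderiv ℝ P.H y)) :=
    (hDH y hyA).tendsto.comp hxη'
  have hlin : ∀ z, Tendsto (fun k => P.linearization (x (η k)) z) atTop
      (𝓝 (P.linearization y z)) := fun z =>
    (((hH y hyA).continuousAt.tendsto.comp hxη).const_sub (P.G z)).sub
      ((isBoundedBilinearMap_apply.continuous.tendsto (fderiv ℝ P.H y, z - y)).comp
        (hDHη.prodMk_nhds (hxη.const_sub z)))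
  have hfinal : ∀ z ∈ P.A,
      ψ y ≤ P.g₀ z - P.h₀ y - inner ℝ w (z - y) + m (P.linearization y z) := fun z hz => by
    rw [← hLy]
    -- The successors `x (η k + 1)` need not converge; only their values `ψ` do, since the whole
    -- sequence of values tends to `L`.
    refine le_of_tendsto_of_tendsto (((tendsto_add_atTop_iff_nat 1).2 hL).comp hηt)
      (((hhη.const_sub (P.g₀ z)).sub (hinner z)).add ((hm.tendsto _).comp (hlin z))) ?_
    filter_upwards [hηt.eventually_ge_atTop N] with k hk using hkey _ hk z hz
  obtain ⟨q, hq, hqF, hqm⟩ := hatt (P.F y)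
  refine ⟨hyA, hT, w, fun z => ?_, q, hq, ⟨hyA, hq, by rwa [linearization_self]⟩, ?_⟩
  · exact le_of_tendsto (hhη.add (hinner z)) (Eventually.of_forall fun k => h.subgradient _ z)
  · rintro ⟨z, r⟩ ⟨hz, hr, hrz⟩
    have h1 := hfinal z hz
    have h2 := hle _ r hr hrz
    simp only [hψ, f₀] at h1
    simp only [penalizedObjective, sub_self, inner_zero_right]
    linarith

end Sequence

end ConeDCProblem

/-! ### Assembly of the theorem -/

theorem mainTheorem11 {d : ℕ} {Y : Type*} [NormedAddCommGroup Y] [NormedSpace ℝ Y]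
    [FiniteDimensional ℝ Y] [Nontrivial Y] (P : ConeDCProblem d Y)
    (hK : IsGeneratingCone P.K)
    (hG : ContinuousOn P.G P.A)
    (hH : ∀ x ∈ P.A, DifferentiableAt ℝ P.H x)
    (hDH : ContinuousOn (fderiv ℝ P.H) P.A)
    (t₀ : Y →L[ℝ] ℝ) (ht₀ : IsStrictlyPositiveOn P.K t₀) :
    ∃ c : ℝ, IsLeast {r : ℝ | ∃ s ∈ P.K, ‖s‖ = 1 ∧ r = t₀ s} c ∧ 0 < c ∧
      (BddBelow (P.penaltyFunction c '' P.A) →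
        ∀ τmax μ ϰ : ℝ, 0 < τmax → 1 < μ → 0 ≤ ϰ →
        ∀ (x v : ℕ → EuclideanSpace ℝ (Fin d)) (s : ℕ → Y) (t : ℕ → Y →L[ℝ] ℝ),
          P.IsPenaltyCCPSequence t₀ τmax μ ϰ x v s t →
          (∃ tlim : Y →L[ℝ] ℝ, Tendsto t atTop (𝓝 tlim) ∧
            ∀ y, IsSeqLimitPoint x y → P.IsGeneralizedCritical tlim y) ∧
          (∀ p : ℕ, IsGreatest {k : ℕ | ‖μ ^ k • t₀‖ ≤ τmax} p →
            (∀ y ∈ P.A, ϰ < P.infeasibility y →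
              ¬ P.IsGeneralizedCritical (μ ^ p • t₀) y) →
            (∀ y, IsSeqLimitPoint x y → P.infeasibility y ≤ ϰ) ∧
            (ϰ = 0 → ∀ y, IsSeqLimitPoint x y → P.IsFeasible y ∧ P.IsCritical y))) := by
  obtain ⟨c, hc, hc0⟩ := ht₀.exists_isLeast hK
  refine ⟨c, hc, hc0, fun hbdd τmax μ ϰ _ hμ _ x v s t h => ?_⟩
  have hμ0 : 0 < μ := one_pos.trans hμ
  have ht₀0 : t₀ ≠ 0 := by
    obtain ⟨y, hy, hy0⟩ := hK.exists_ne_zero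
    rintro rfl
    exact lt_irrefl _ (ht₀.2 y hy hy0)
  obtain ⟨q, N, hq, hN⟩ := h.exists_eventually_eq hμ ht₀0
  have hT : IsStrictlyPositiveOn P.K (μ ^ q • t₀) :=
    ⟨fun y hy => mul_nonneg (by positivity) (ht₀.1 y hy),
      fun y hy hy0 => mul_pos (by positivity) (ht₀.2 y hy hy0)⟩
  obtain ⟨m, hm, hmono, hatt, hle⟩ := exists_penaltyValue hK hT
  have hbdd' : BddBelow ((fun x => P.f₀ x + m (P.F x)) '' P.A) := by
    obtain ⟨b, hb⟩ := hbdd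
    refine ⟨b, ?_⟩
    rintro _ ⟨z, hz, rfl⟩
    refine (hb ⟨z, hz, rfl⟩).trans ?_
    obtain ⟨r, hr, hrF, hrm⟩ := hatt (P.F z)
    have h1 := mul_le_mul_of_nonneg_left (ConeDCProblem.infeasibility_le_norm hrF) hc0.le
    have h2 := mul_norm_le_of_isLeast hc hr
    -- Because `μ ^ q ≥ 1`, the bound assumed for `c` serves every later parameter.
    have h3 : t₀ r ≤ (μ ^ q • t₀) r := le_mul_of_one_le_left (ht₀.1 r hr) (one_le_pow₀ hμ.le)
    simp only [ConeDCProblem.penaltyFunction]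
    linarith
  have hcrit : ∀ y, IsSeqLimitPoint x y → P.IsGeneralizedCritical (μ ^ q • t₀) y := fun y hy =>
    h.isGeneralizedCritical hG hH hDH hT hN hm hmono hatt hle hbdd' hy
  refine ⟨⟨_, tendsto_const_nhds.congr' ?_, hcrit⟩, fun p hp hno => ?_⟩
  · filter_upwards [eventually_ge_atTop N] with n hn using (hN n hn).symm
  have hinf : ∀ y, IsSeqLimitPoint x y → P.infeasibility y ≤ ϰ := fun y hy => by
    have hyA := h.mem_of_limitPoint hy
    have hqp : q ≤ p := by
      rcases hq with rfl | hq
      · exact Nat.zero_le _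
      · exact hp.2 hq
    -- If `q < p`, one more multiplication by `μ` stays within `τmax`, so a slack above `ϰ` after
    -- index `N` would change the constant parameter.
    rcases hqp.eq_or_lt with rfl | hlt
    · by_contra! hy'
      exact hno y hyA hy' (hcrit y hy)
    · refine ConeDCProblem.infeasibility_le_of_limitPoint (ConeDCProblem.continuousOn_F hG hH)
        h.mem (N := N + 1) (fun n hn => ?_) hyA hy
      obtain ⟨n, rfl⟩ : ∃ k, n = k + 1 := ⟨n - 1, by omega⟩
      refine (h.infeasibility_le_norm hH n).trans ?_
      by_contra! hs
      have hnorm : μ * ‖t n‖ ≤ τmax := by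
        have hp1 : ‖μ ^ p • t₀‖ ≤ τmax := hp.1
        rw [norm_smul, norm_pow, Real.norm_of_nonneg hμ0.le] at hp1
        rw [hN n (by omega), norm_smul, norm_pow, Real.norm_of_nonneg hμ0.le, ← mul_assoc,
          ← pow_succ']
        exact (mul_le_mul_of_nonneg_right (pow_le_pow_right₀ hμ.le hlt) (norm_nonneg _)).trans hp1
      have h1 := h.t_succ n
      rw [if_pos ⟨hs.le, hnorm⟩, hN n (by omega), hN (n + 1) (by omega)] at h1
      have h2 : ‖μ ^ q • t₀‖ = μ * ‖μ ^ q • t₀‖ := by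
        conv_lhs => rw [h1]
        rw [norm_smul, Real.norm_of_nonneg hμ0.le]
      have h3 : 0 < ‖μ ^ q • t₀‖ := norm_pos_iff.2 (smul_ne_zero (by positivity) ht₀0)
      nlinarith
  refine ⟨hinf, ?_⟩
  rintro rfl y hy
  have hF : -P.F y ∈ P.K := ConeDCProblem.neg_F_mem_of_infeasibility_eq_zero
    (le_antisymm (hinf y hy) Metric.infDist_nonneg)
  exact ⟨⟨h.mem_of_limitPoint hy, hF⟩, (hcrit y hy).isCritical hF⟩
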